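/- For $v\ge 1$ let $[v]=\{0,1,\dots,v-1\}$ and let $|0\rangle,\dots,|v-1\rangle$ be the computational (standard) basis of $\mathbb{C}^v$. A *quantum Latin square* of dimension $v$ is a $v\times v$ array $\Phi=(|\Phi_{ij}\rangle)_{i,j\in[v]}$ of vectors of $\mathbb{C}^v$ such that every row and every column is an orthonormal basis of $\mathbb{C}^v$. Two $v\times v$ arrays $\Phi,\Psi$ of vectors of $\mathbb{C}^v$ are *equivalent* if there are a unitary operator $U$ on $\mathbb{C}^v$, complex numbers $c_{ij}$ of modulus $1$ and permutations $\sigma,\tau$ of $[v]$ such that $|\Psi_{ij}\rangle=c_{ij}\,U|\Phi_{\sigma(i),\tau(j)}\rangle$ for all $i,j\in[v]$. A quantum Latin square is *classical* if it is equivalent to $(|L_{ij}\rangle)_{i,j\in[v]}$ for some Latin square $L=(L_{ij})$ of order $v$ on the symbols $[v]$, and *non-classical* otherwise. Two quantum Latin squares $\Phi,\Psi$ of dimension $v$ are *orthogonal* if the family $(|\Phi_{ij}\rangle\otimes|\Psi_{ij}\rangle)_{i,j\in[v]}$ is an orthonormal basis of $\mathbb{C}^v\otimes\mathbb{C}^v$.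 **Theorem.** For every integer $v\ge 8$ there exist two orthogonal quantum Latin squares of dimension $v$, both of which are non-classical. -/

import Mathlib

open scoped TensorProduct

/-- `ℂ^v` with its standard Hermitian inner product. -/
abbrev QSpace (v : ℕ) : Type := EuclideanSpace ℂ (Fin v)

/-- A `v × v` array of vectors of `ℂ^v`. -/
abbrev QArray (v : ℕ) : Type := Fin v → Fin v → QSpace v

/-- The indexed family of vectors `f` is an orthonormal basis of `E`. -/
def FormsONB {ι E : Type*} [Fintype ι] [NormedAddCommGroup E] [InnerProductSpace ℂ E]
    (f : ι → E) : Prop :=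
  ∃ b : OrthonormalBasis ι ℂ E, ∀ i, b i = f i

/-- Quantum Latin square of dimension `v`: every row and every column is an orthonormal basis
of `ℂ^v`. -/
structure IsQLS {v : ℕ} (Φ : QArray v) : Prop where
  row : ∀ i, FormsONB (fun j => Φ i j)
  col : ∀ j, FormsONB (fun i => Φ i j)

/-- Latin square of order `v`: every symbol occurs exactly once in each row and each column. -/
structure IsLatinSquare {v : ℕ} (L : Fin v → Fin v → Fin v) : Prop where
  row : ∀ i l, ∃! j, L i j = l
  col : ∀ j l, ∃! i, L i j = l

/-- The array obtained from an array of symbols by placing the computational basis vector `|l⟩`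
instead of `l`. -/
noncomputable def ketArray {v : ℕ} (L : Fin v → Fin v → Fin v) : QArray v :=
  fun i j => EuclideanSpace.single (L i j) (1 : ℂ)

/-- Equivalence of arrays: `Ψ i j = c i j • U (Φ (σ i) (τ j))` with `U` unitary, all `c i j` of
modulus `1`, and `σ`, `τ` permutations. -/
def QEquivalent {v : ℕ} (Φ Ψ : QArray v) : Prop :=
  ∃ (U : QSpace v ≃ₗᵢ[ℂ] QSpace v) (c : Fin v → Fin v → ℂ) (σ τ : Equiv.Perm (Fin v)),
    (∀ i j, ‖c i j‖ = 1) ∧ ∀ i j, Ψ i j = c i j • U (Φ (σ i) (τ j))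

/-- Classical arrays: those equivalent to the array of kets of a Latin square. -/
def IsClassical {v : ℕ} (Φ : QArray v) : Prop :=
  ∃ L : Fin v → Fin v → Fin v, IsLatinSquare L ∧ QEquivalent (ketArray L) Φ

/-- Two arrays are orthogonal if the vectors `|Φ i j⟩ ⊗ |Ψ i j⟩`, over all cells `(i, j)`, form
an orthonormal basis of `ℂ^v ⊗ ℂ^v`. -/
def QOrthogonal {v : ℕ} (Φ Ψ : QArray v) : Prop :=
  FormsONB (fun p : Fin v × Fin v => Φ p.1 p.2 ⊗ₜ[ℂ] Ψ p.1 p.2)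

/-- `t`-MOQLS(`v`): `t` quantum Latin squares of dimension `v`, pairwise orthogonal. -/
structure IsMOQLS {t v : ℕ} (Φ : Fin t → QArray v) : Prop where
  qls : ∀ k, IsQLS (Φ k)
  orthogonal : ∀ k l, k < l → QOrthogonal (Φ k) (Φ l)

/-- Non-classical `t`-MOQLS(`v`): each of the `t` mutually orthogonal quantum Latin squares is
non-classical. -/
def IsNonclassicalMOQLS {t v : ℕ} (Φ : Fin t → QArray v) : Prop :=
  IsMOQLS Φ ∧ ∀ k, ¬ IsClassical (Φ k)

/-!
A pair of orthogonal Latin squares of order `v` is a transversal design with four groups: the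
`v ^ 2` quadruples `(i, j, L i j, M i j)`, any two of whose coordinates determine the quadruple.
To leave the classical world, fix a set `D` of such quadruples (blocks) and, for the blocks of `D`
only, rotate the kets of two symbols `a`, `b` of `L` by the angle with cosine `3 / 5`, and likewise
two symbols of `M`. Two blocks, one in `D` and one not, can fail to be orthogonal in a coordinate
only if they agree there up to exchanging the two rotated symbols. So everything stays orthonormal
as soon as `D` is closed under agreement, in this weaker sense, in two coordinates (`IsTwist`,
`IsTwist.inner_mul_inner`). The result is non-classical because `a` occurs both inside and
outside `D`, which produces two vectors with inner product `3 / 5`, whereas in a classical array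
inner products have modulus `0` or `1` (`exists_isNonclassicalMOQLS_of_twistable`). For instance the
blocks of a proper subdesign always form such a set `D` (`IsTD.twistable`).

It remains to find, for each `v ≥ 8`, a transversal design with such a set `D`.

* Except for `v = 8, 9, 10, 11, 14` one can write `v = t * m + u` with `m ∈ {3, 4}`, with
  `u < t` either zero or odd, and with `t` prime to `6` or in `{4, 8, 9, 16}`
  (`exists_isWilsonTriple`). Wilson's construction, applied to a linear transversal design of order
  `t` with five groups, one of which is truncated to `u` points, then gives a design of order `v`.
  As `u < t`, some block misses the truncated group, and over it lies a subdesign of order `m`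
  (`twistable_wilson`).
* For `v = 9, 10, 11, 14`, a quasi-difference table over `ℤ / (v - 3)` with three infinite points
  gives a design whose infinite points span a subdesign of order three
  (`IsQuasiDifference.twistable`).
* For `v = 8` a proper subdesign of order at least three cannot exist, but in the linear design
  over the field with eight elements the blocks whose first coordinate lies in a suitable proper
  subgroup are closed in the required sense (`twistable_of_field`).
-/

/-! ### Transversal designs and twists -/

/-- A transversal design, given by its set `B` of blocks. Every group (indexed by `ι`) has the point
set `α`, a block is the function sending each group to the point it has there, and two points of
different groups lie on exactly one common block. -/
def IsTD {ι α : Type*} (B : Set (ι → α)) : Prop :=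
  ∀ ⦃k l : ι⦄, k ≠ l → ∀ x y : α, ∃! f, f ∈ B ∧ f k = x ∧ f l = y

/-- `x` and `y` become equal when the two points `a` and `b` are identified. -/
def Merged {α : Type*} (a b x y : α) : Prop :=
  x = y ∨ ((x = a ∨ x = b) ∧ (y = a ∨ y = b))

/-- `D` is a set of blocks of `B` on which the kets of `a k` and `b k` may be rotated among
themselves, for each coordinate `k`. Coordinates `0` and `1` are the row and the column and are not
rotated, which is encoded by `a k = b k`; coordinates `2` and `3` are the symbols of the two
squares, where the rotated symbol `a k` has to occur both inside and outside `D`. -/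
structure IsTwist {α : Type*} (B D : Set (Fin 4 → α)) (a b : Fin 4 → α) : Prop where
  closed : ∀ f ∈ B, ∀ g ∈ B, ∀ k l, k ≠ l → Merged (a k) (b k) (f k) (g k) →
    Merged (a l) (b l) (f l) (g l) → f ∈ D → g ∈ D
  row : a 0 = b 0
  col : a 1 = b 1
  ne : ∀ k, 2 ≤ k → a k ≠ b k
  exists_mem : ∀ k, 2 ≤ k → ∃ f ∈ B, f ∈ D ∧ f k = a k
  exists_notMem : ∀ k, 2 ≤ k → ∃ f ∈ B, f ∉ D ∧ f k = a k

/-- Some pair of orthogonal Latin squares on the symbols `α` admits a twist. -/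
def Twistable (α : Type*) : Prop :=
  ∃ (B D : Set (Fin 4 → α)) (a b : Fin 4 → α), IsTD B ∧ IsTwist B D a b

theorem Merged.symm {α : Type*} {a b x y : α} (h : Merged a b x y) : Merged a b y x := by
  rcases h with h | h
  · exact Or.inl h.symm
  · exact Or.inr h.symm

theorem merged_self {α : Type*} {a x y : α} : Merged a a x y ↔ x = y := by
  unfold Merged; grind

/-! ### Twisted pairs of quantum Latin squares -/

open Classical in
/-- The image of the ket of `x` under the rotation by the angle with cosine `3 / 5` of the plane
spanned by the kets of `a` and `b`; the rotation is the identity if `a = b`. -/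
noncomputable def rotatedKet {v : ℕ} (a b x : Fin v) : QSpace v :=
  if a = b then EuclideanSpace.single x 1
  else if x = a then
    (3 / 5 : ℂ) • EuclideanSpace.single a 1 + (4 / 5 : ℂ) • EuclideanSpace.single b 1
  else if x = b then
    (-(4 / 5) : ℂ) • EuclideanSpace.single a 1 + (3 / 5 : ℂ) • EuclideanSpace.single b 1
  else EuclideanSpace.single x 1

theorem inner_ket {v : ℕ} (x y : Fin v) :
    inner ℂ (EuclideanSpace.single x (1 : ℂ)) (EuclideanSpace.single y (1 : ℂ)) =
      if x = y then 1 else 0 := by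
  simp [EuclideanSpace.inner_single_left]

theorem inner_rotatedKet {v : ℕ} (a b x y : Fin v) :
    inner ℂ (rotatedKet a b x) (rotatedKet a b y) = if x = y then (1 : ℂ) else 0 := by
  have h3 : starRingEnd ℂ (3 / 5 : ℂ) = 3 / 5 := by
    rw [map_div₀, map_ofNat, map_ofNat]
  have h4 : starRingEnd ℂ (4 / 5 : ℂ) = 4 / 5 := by
    rw [map_div₀, map_ofNat, map_ofNat]
  unfold rotatedKet
  split_ifs <;>
    simp only [inner_add_left, inner_add_right, inner_smul_left, inner_smul_right, inner_ket,
      map_neg, h3, h4] <;> split_ifs <;> first | (norm_num; done) | grind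

theorem merged_of_inner_rotatedKet_ne_zero {v : ℕ} {a b x y : Fin v}
    (h : inner ℂ (EuclideanSpace.single x (1 : ℂ)) (rotatedKet a b y) ≠ 0) : Merged a b x y := by
  unfold Merged
  contrapose! h
  unfold rotatedKet
  split_ifs <;> simp only [inner_add_right, inner_smul_right, inner_ket] <;> split_ifs <;>
    first | (norm_num; done) | grind

theorem inner_ket_rotatedKet_self {v : ℕ} {a b : Fin v} (h : a ≠ b) :
    inner ℂ (EuclideanSpace.single a (1 : ℂ)) (rotatedKet a b a) = 3 / 5 := by
  simp only [rotatedKet, h, if_true, if_false, inner_add_right, inner_smul_right, inner_ket]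
  norm_num

theorem formsONB_of_inner {ι E : Type*} [Fintype ι] [DecidableEq ι] [Nonempty ι]
    [NormedAddCommGroup E] [InnerProductSpace ℂ E] (f : ι → E)
    (hf : ∀ i j, inner ℂ (f i) (f j) = if i = j then (1 : ℂ) else 0)
    (hcard : Fintype.card ι = Module.finrank ℂ E) : FormsONB f := by
  have ho : Orthonormal ℂ f := orthonormal_iff_ite.2 hf
  refine ⟨OrthonormalBasis.mk (v := f) ho ?_, fun i => by rw [OrthonormalBasis.coe_mk]⟩
  rw [← coe_basisOfOrthonormalOfCardEqFinrank ho hcard, Module.Basis.span_eq]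

theorem norm_inner_of_isClassical {v : ℕ} {Φ : QArray v} (h : IsClassical Φ) (i j i' j' : Fin v) :
    ‖(inner ℂ (Φ i j) (Φ i' j') : ℂ)‖ = 0 ∨ ‖(inner ℂ (Φ i j) (Φ i' j') : ℂ)‖ = 1 := by
  obtain ⟨L, -, U, c, σ, τ, hc, hΦ⟩ := h
  simp only [hΦ, inner_smul_left, inner_smul_right, LinearIsometryEquiv.inner_map_map, ketArray,
    inner_ket, norm_mul, RCLike.norm_conj, hc]
  split_ifs <;> simp

theorem IsTD.eq_of_agree {ι α : Type*} {B : Set (ι → α)} (hB : IsTD B) {f g : ι → α} (hf : f ∈ B)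
    (hg : g ∈ B) {k l : ι} (hkl : k ≠ l) (hk : f k = g k) (hl : f l = g l) : f = g :=
  (hB hkl (g k) (g l)).unique ⟨hf, hk, hl⟩ ⟨hg, rfl, rfl⟩

open Classical in
/-- The vector attached to the coordinate `k` of the block `f`: rotated on `D`, a plain ket
elsewhere. -/
noncomputable def twistedKet {v : ℕ} (D : Set (Fin 4 → Fin v)) (a b : Fin 4 → Fin v)
    (k : Fin 4) (f : Fin 4 → Fin v) : QSpace v :=
  if f ∈ D then rotatedKet (a k) (b k) (f k) else EuclideanSpace.single (f k) 1

theorem twistedKet_of_eq {v : ℕ} (D : Set (Fin 4 → Fin v)) {a b : Fin 4 → Fin v} {k : Fin 4}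
    (h : a k = b k) (f : Fin 4 → Fin v) : twistedKet D a b k f = EuclideanSpace.single (f k) 1 := by
  simp [twistedKet, rotatedKet, h]

theorem inner_twistedKet_of_iff {v : ℕ} {D : Set (Fin 4 → Fin v)} {a b : Fin 4 → Fin v}
    {f g : Fin 4 → Fin v} (h : f ∈ D ↔ g ∈ D) (k : Fin 4) :
    inner ℂ (twistedKet D a b k f) (twistedKet D a b k g) = if f k = g k then (1 : ℂ) else 0 := by
  unfold twistedKet
  by_cases hg : g ∈ D
  · rw [if_pos (h.2 hg), if_pos hg, inner_rotatedKet]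
  · rw [if_neg (mt h.1 hg), if_neg hg, inner_ket]

theorem merged_of_inner_twistedKet_ne_zero {v : ℕ} {D : Set (Fin 4 → Fin v)} {a b : Fin 4 → Fin v}
    {f g : Fin 4 → Fin v} (hf : f ∈ D) (hg : g ∉ D) {k : Fin 4}
    (h : inner ℂ (twistedKet D a b k f) (twistedKet D a b k g) ≠ 0) :
    Merged (a k) (b k) (f k) (g k) := by
  rw [twistedKet, twistedKet, if_pos hf, if_neg hg, ← inner_conj_symm] at h
  exact (merged_of_inner_rotatedKet_ne_zero (fun h0 => h (by rw [h0, map_zero]))).symm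

/-- In any two coordinates the twisted vectors of the blocks form an orthonormal family of product
vectors. The coordinate pairs `(0, k)` and `(1, k)` give the orthonormality of rows and columns, the
pair `(2, 3)` the orthogonality of the two squares. -/
theorem IsTwist.inner_mul_inner {v : ℕ} {B D : Set (Fin 4 → Fin v)} {a b : Fin 4 → Fin v}
    (hB : IsTD B) (hD : IsTwist B D a b) {f g : Fin 4 → Fin v} (hf : f ∈ B) (hg : g ∈ B)
    {k l : Fin 4} (hkl : k ≠ l) :
    inner ℂ (twistedKet D a b k f) (twistedKet D a b k g) *
      inner ℂ (twistedKet D a b l f) (twistedKet D a b l g) = if f = g then (1 : ℂ) else 0 := by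
  by_cases h : f ∈ D ↔ g ∈ D
  · rw [inner_twistedKet_of_iff h, inner_twistedKet_of_iff h]
    by_cases hfg : f = g
    · simp [hfg]
    · rw [if_neg hfg]
      by_cases hk : f k = g k
      · have hl : f l ≠ g l := fun hl => hfg (hB.eq_of_agree hf hg hkl hk hl)
        simp [hl]
      · simp [hk]
  · have hfg : f ≠ g := fun e => h (by rw [e])
    rw [if_neg hfg]
    by_contra hne
    obtain ⟨hk, hl⟩ := mul_ne_zero_iff.1 hne
    by_cases hfD : f ∈ D
    · have hgD : g ∉ D := fun hgD => h (by simp [hfD, hgD])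
      exact hgD (hD.closed f hf g hg k l hkl (merged_of_inner_twistedKet_ne_zero hfD hgD hk)
        (merged_of_inner_twistedKet_ne_zero hfD hgD hl) hfD)
    · have hgD : g ∈ D := by by_contra hgD; exact h (by simp [hfD, hgD])
      rw [← inner_conj_symm, map_ne_zero] at hk hl
      exact hfD (hD.closed g hg f hf k l hkl (merged_of_inner_twistedKet_ne_zero hgD hfD hk)
        (merged_of_inner_twistedKet_ne_zero hgD hfD hl) hgD)

theorem exists_isNonclassicalMOQLS_of_twistable {v : ℕ} (hv : 0 < v) (h : Twistable (Fin v)) :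
    ∃ Φ : Fin 2 → QArray v, IsNonclassicalMOQLS Φ := by
  obtain ⟨B, D, a, b, hB, hD⟩ := h
  have : Nonempty (Fin v) := ⟨⟨0, hv⟩⟩
  have h01 : (0 : Fin 4) ≠ 1 := by decide
  choose F hFB hF0 hF1 using fun i j => (hB h01 i j).exists
  have hFinj : ∀ i j i' j', F i j = F i' j' ↔ i = i' ∧ j = j' := fun i j i' j' =>
    ⟨fun e => ⟨by rw [← hF0 i j, e, hF0], by rw [← hF1 i j, e, hF1]⟩, fun e => by rw [e.1, e.2]⟩
  have hFeq : ∀ f ∈ B, F (f 0) (f 1) = f := fun f hf =>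
    hB.eq_of_agree (hFB _ _) hf h01 (hF0 _ _) (hF1 _ _)
  have key := fun i j i' j' k l (hkl : k ≠ l) =>
    hD.inner_mul_inner hB (hFB i j) (hFB i' j') hkl
  have hQLS : ∀ k, 2 ≤ k → IsQLS (fun i j => twistedKet D a b k (F i j)) := by
    intro k hk
    refine ⟨fun i => formsONB_of_inner _ (fun j j' => ?_) (by simp),
      fun j => formsONB_of_inner _ (fun i i' => ?_) (by simp)⟩
    · have := key i j i j' 0 k (by rintro rfl; exact absurd hk (by decide))
      simpa [twistedKet_of_eq D hD.row, hF0, inner_ket, hFinj] using this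
    · have := key i j i' j 1 k (by rintro rfl; exact absurd hk (by decide))
      simpa [twistedKet_of_eq D hD.col, hF1, inner_ket, hFinj] using this
  have hNC : ∀ k, 2 ≤ k → ¬ IsClassical (fun i j => twistedKet D a b k (F i j)) := by
    intro k hk hcl
    obtain ⟨f, hfB, hfD, hfk⟩ := hD.exists_notMem k hk
    obtain ⟨g, hgB, hgD, hgk⟩ := hD.exists_mem k hk
    -- the symbol `a k` in an unrotated and in a rotated cell gives the inner product `3 / 5`
    have h := norm_inner_of_isClassical hcl (f 0) (f 1) (g 0) (g 1)
    simp only [hFeq f hfB, hFeq g hgB] at h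
    rw [twistedKet, twistedKet, if_neg hfD, if_pos hgD, hfk, hgk,
      inner_ket_rotatedKet_self (hD.ne k hk)] at h
    norm_num at h
  refine ⟨![fun i j => twistedKet D a b 2 (F i j), fun i j => twistedKet D a b 3 (F i j)],
    ⟨fun k => ?_, fun k l hkl => ?_⟩, fun k => ?_⟩
  · fin_cases k
    · exact hQLS 2 (by decide)
    · exact hQLS 3 (by decide)
  · have hk : k = 0 := by omega
    have hl : l = 1 := by omega
    subst hk hl
    refine formsONB_of_inner _ (fun p q => ?_) (by simp [Module.finrank_tensorProduct])
    simp only [Matrix.cons_val_zero, Matrix.cons_val_one, TensorProduct.inner_tmul]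
    rw [key p.1 p.2 q.1 q.2 2 3 (by decide)]
    simp [hFinj, Prod.ext_iff]
  · fin_cases k
    · exact hNC 2 (by decide)
    · exact hNC 3 (by decide)

/-! ### Subdesigns -/

theorem IsTD.map {ι α β : Type*} {B : Set (ι → α)} (hB : IsTD B) (e : α ≃ β) :
    IsTD {f : ι → β | (fun k => e.symm (f k)) ∈ B} := by
  intro k l hkl x y
  obtain ⟨f, ⟨hf, hk, hl⟩, hu⟩ := hB hkl (e.symm x) (e.symm y)
  refine ⟨fun m => e (f m), ⟨by simpa using hf, by simp [hk], by simp [hl]⟩, ?_⟩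
  rintro g ⟨hg, rfl, rfl⟩
  rw [← hu _ ⟨hg, rfl, rfl⟩]
  simp

theorem Merged.map {α β : Type*} {a b x y : α} (e : α → β) (h : Merged a b x y) :
    Merged (e a) (e b) (e x) (e y) := by
  unfold Merged at *; grind

theorem Twistable.map {α β : Type*} (h : Twistable α) (e : α ≃ β) : Twistable β := by
  obtain ⟨B, D, a, b, hB, hD⟩ := h
  refine ⟨_, {f | (fun k => e.symm (f k)) ∈ D}, fun k => e (a k), fun k => e (b k), hB.map e, ?_⟩
  refine ⟨fun f hf g hg k l hkl hk hl => ?_, by rw [hD.row], by rw [hD.col],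
    fun k hk => e.injective.ne (hD.ne k hk), fun k hk => ?_, fun k hk => ?_⟩
  · exact hD.closed _ hf _ hg k l hkl (by simpa using hk.map e.symm) (by simpa using hl.map e.symm)
  · obtain ⟨f, hf, hfD, hfk⟩ := hD.exists_mem k hk
    exact ⟨fun m => e (f m), by simpa using hf, by simpa using hfD, by simp [hfk]⟩
  · obtain ⟨f, hf, hfD, hfk⟩ := hD.exists_notMem k hk
    exact ⟨fun m => e (f m), by simpa using hf, by simpa using hfD, by simp [hfk]⟩

theorem Merged.mem {α : Type*} {a b x y : α} (h : Merged a b x y) {S : Set α} (ha : a ∈ S)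
    (hb : b ∈ S) (hx : x ∈ S) : y ∈ S := by
  rcases h with rfl | ⟨-, rfl | rfl⟩ <;> assumption

/-- The blocks of a proper subdesign, with point set `S k` in the group `k`, can be twisted: a block
sharing two points of the subdesign, even up to exchanging `a k` and `b k`, belongs to it. -/
theorem IsTD.twistable {α : Type*} {B : Set (Fin 4 → α)} (hB : IsTD B) (S : Fin 4 → Set α)
    (hS : ∀ f ∈ B, ∀ k l, k ≠ l → f k ∈ S k → f l ∈ S l → ∀ m, f m ∈ S m)
    (hnt : ∀ k, (S k).Nontrivial) (h0 : S 0 ≠ Set.univ) : Twistable α := by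
  choose s hs t ht hst using hnt
  -- the rotated symbols are `s k` and `t k`, except that rows and columns are not rotated
  have hmem : ∀ k, Function.update (Function.update t 0 (s 0)) 1 (s 1) k ∈ S k := by
    intro k; fin_cases k <;> simp [hs, ht]
  refine ⟨B, {f | ∀ m, f m ∈ S m}, s, Function.update (Function.update t 0 (s 0)) 1 (s 1), hB, ?_⟩
  refine ⟨fun f hf g hg k l hkl hk hl hfD => ?_, by simp, by simp, fun k hk => ?_, fun k hk => ?_,
    fun k hk => ?_⟩
  · exact hS g hg k l hkl (hk.mem (hs k) (hmem k) (hfD k)) (hl.mem (hs l) (hmem l) (hfD l))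
  · have h0 : k ≠ 0 := by rintro rfl; exact absurd hk (by decide)
    have h1 : k ≠ 1 := by rintro rfl; exact absurd hk (by decide)
    simpa [h0, h1] using hst k
  all_goals have hk0 : (0 : Fin 4) ≠ k := by rintro rfl; exact absurd hk (by decide)
  · obtain ⟨f, hf, hf0, hfk⟩ := (hB hk0 (s 0) (s k)).exists
    exact ⟨f, hf, hS f hf 0 k hk0 (hf0 ▸ hs 0) (hfk ▸ hs k), hfk⟩
  · obtain ⟨x, hx⟩ := (Set.ne_univ_iff_exists_notMem _).1 h0
    obtain ⟨f, hf, hf0, hfk⟩ := (hB hk0 x (s k)).exists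
    exact ⟨f, hf, fun h => hx (hf0 ▸ h 0), hfk⟩

/-! ### Linear designs -/

/-- The blocks `k ↦ c k * x + d k * y` for `(x, y)` in `R × R`. -/
def linearBlocks {ι R : Type*} [CommRing R] (c d : ι → R) : Set (ι → R) :=
  Set.range fun p : R × R => fun k => c k * p.1 + d k * p.2

/-- Cramer's rule recovers `(x, y)` from any two coordinates. -/
theorem isTD_linearBlocks {ι R : Type*} [CommRing R] {c d : ι → R}
    (h : ∀ k l, k ≠ l → IsUnit (c k * d l - c l * d k)) : IsTD (linearBlocks c d) := by
  intro k l hkl x y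
  obtain ⟨w, hw⟩ := (h k l hkl).exists_right_inv
  refine ⟨_, ⟨⟨(w * (d l * x - d k * y), w * (c k * y - c l * x)), rfl⟩, ?_, ?_⟩, ?_⟩
  · linear_combination x * hw
  · linear_combination y * hw
  · rintro _ ⟨⟨⟨p, q⟩, rfl⟩, rfl, rfl⟩
    funext m
    linear_combination (-(c m * p + d m * q)) * hw

theorem zero_mem_linearBlocks {ι R : Type*} [CommRing R] (c d : ι → R) :
    (fun _ => 0) ∈ linearBlocks c d :=
  ⟨0, by simp⟩

theorem exists_isTD_four {R : Type*} [CommRing R] {s : R} (hs : IsUnit s) (hs1 : IsUnit (s - 1)) :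
    ∃ B : Set (Fin 4 → R), IsTD B ∧ (fun _ => 0) ∈ B := by
  refine ⟨linearBlocks ![1, 0, 1, 1] ![0, 1, 1, s], isTD_linearBlocks fun k l hkl => ?_,
    zero_mem_linearBlocks _ _⟩
  have hs1' : IsUnit (1 - s) := by rw [← neg_sub]; exact hs1.neg
  fin_cases k <;> fin_cases l <;> simp at hkl ⊢ <;> assumption

theorem exists_isTD_five {R : Type*} [CommRing R] {s t : R} (hs : IsUnit s) (hs1 : IsUnit (s - 1))
    (ht : IsUnit t) (ht1 : IsUnit (t - 1)) (hst : IsUnit (t - s)) :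
    ∃ B : Set (Option (Fin 4) → R), IsTD B := by
  refine ⟨_, isTD_linearBlocks (c := fun k => k.elim 1 ![1, 0, 1, 1])
    (d := fun k => k.elim t ![0, 1, 1, s]) fun k l hkl => ?_⟩
  have hs1' : IsUnit (1 - s) := by rw [← neg_sub]; exact hs1.neg
  have ht1' : IsUnit (1 - t) := by rw [← neg_sub]; exact ht1.neg
  have hst' : IsUnit (s - t) := by rw [← neg_sub]; exact hst.neg
  rcases k with _ | k <;> rcases l with _ | l
  · exact absurd rfl hkl
  · fin_cases l <;> simp <;> assumption
  · fin_cases k <;> simp <;> assumption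
  · fin_cases k <;> fin_cases l <;> simp at hkl ⊢ <;> assumption

/-! ### Wilson's construction -/

/-- The blocks of Wilson's construction. The last group `none` of the design `B` is truncated to the
image of `U`; every point of the other groups is given weight `M`, and `U` is added to each group.
* Over a block of `B` missing the truncated group a copy of `C` is put.
* Over a block of `B` meeting the truncated group in `u` a copy of `C'` is put, with `u` in the role
  of `none`, and its block consisting of `u` only is left out.
* The points of `U` are filled with the design `E`. -/
inductive WilsonBlock {ι T M U : Type*} (e : U → T) (B : Set (Option ι → T)) (C : Set (ι → M))
    (C' : Set (ι → Option M)) (E : Set (ι → U)) : (ι → T × M ⊕ U) → Prop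
  | missing (g : Option ι → T) (h : ι → M) (hg : g ∈ B) (hgU : g none ∉ Set.range e) (hh : h ∈ C) :
      WilsonBlock e B C C' E fun k => Sum.inl (g (some k), h k)
  | meeting (g : Option ι → T) (u : U) (h : ι → Option M) (hg : g ∈ B) (hgu : g none = e u)
      (hh : h ∈ C') (hne : h ≠ fun _ => none) :
      WilsonBlock e B C C' E fun k => (h k).elim (Sum.inr u) fun c => Sum.inl (g (some k), c)
  | hole (h : ι → U) (hh : h ∈ E) : WilsonBlock e B C C' E fun k => Sum.inr (h k)

theorem isTD_wilsonBlock {ι T M U : Type*} {e : U → T} (he : Function.Injective e)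
    {B : Set (Option ι → T)} {C : Set (ι → M)} {C' : Set (ι → Option M)} {E : Set (ι → U)}
    (hB : IsTD B) (hC : IsTD C) (hC' : IsTD C') (hnone : (fun _ => none) ∈ C') (hE : IsTD E) :
    IsTD {f | WilsonBlock e B C C' E f} := by
  have hinr : ∀ k l, k ≠ l → ∀ i c u, ∃! f, WilsonBlock e B C C' E f ∧ f k = Sum.inl (i, c) ∧
      f l = Sum.inr u := by
    intro k l hkl i c u
    obtain ⟨g, ⟨hg, hgk, hgu⟩, hgu'⟩ := hB (Option.some_ne_none k) i (e u)
    obtain ⟨h, ⟨hh, hhk, hhl⟩, hhu⟩ := hC' hkl (some c) none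
    refine ⟨_, ⟨.meeting g u h hg hgu hh (fun h0 => by simp [h0] at hhk), by simp [hhk, hgk],
      by simp [hhl]⟩, ?_⟩
    rintro _ ⟨⟨g', h', hg', hgU', hh'⟩ | ⟨g', u', h', hg', hgu2, hh', hne'⟩ | ⟨h', hh'⟩, hk, hl⟩
    · simp at hl
    · rcases hk' : h' k with _ | c' <;> rcases hl' : h' l with _ | d' <;> simp [hk', hl'] at hk hl
      obtain ⟨rfl, rfl⟩ := hk
      subst hl
      rw [hhu h' ⟨hh', hk', hl'⟩, hgu' g' ⟨hg', rfl, hgu2⟩]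
    · simp at hk
  intro k l hkl x y
  rcases x with ⟨i, c⟩ | u <;> rcases y with ⟨j, d⟩ | w
  · obtain ⟨g, ⟨hg, hgk, hgl⟩, hgu⟩ := hB (fun h => hkl (Option.some_injective _ h)) i j
    by_cases hr : g none ∈ Set.range e
    · obtain ⟨u, hu⟩ := hr
      obtain ⟨h, ⟨hh, hhk, hhl⟩, hhu⟩ := hC' hkl (some c) (some d)
      refine ⟨_, ⟨.meeting g u h hg hu.symm hh (fun h0 => by simp [h0] at hhk), by simp [hhk, hgk],
        by simp [hhl, hgl]⟩, ?_⟩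
      rintro _ ⟨⟨g', h', hg', hgU', hh'⟩ | ⟨g', u', h', hg', hgu2, hh', hne'⟩ | ⟨h', hh'⟩, hk, hl⟩
      · simp at hk hl
        obtain rfl := hgu g' ⟨hg', hk.1, hl.1⟩
        exact absurd ⟨u, hu⟩ hgU'
      · rcases hk' : h' k with _ | c' <;> rcases hl' : h' l with _ | d' <;>
          simp [hk', hl'] at hk hl
        obtain ⟨hk1, rfl⟩ := hk
        obtain ⟨hl1, rfl⟩ := hl
        obtain rfl := hgu g' ⟨hg', hk1, hl1⟩
        obtain rfl := he (hu.trans hgu2)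
        rw [hhu h' ⟨hh', hk', hl'⟩]
      · simp at hk
    · obtain ⟨h, ⟨hh, hhk, hhl⟩, hhu⟩ := hC hkl c d
      refine ⟨_, ⟨.missing g h hg hr hh, by simp [hhk, hgk], by simp [hhl, hgl]⟩, ?_⟩
      rintro _ ⟨⟨g', h', hg', hgU', hh'⟩ | ⟨g', u', h', hg', hgu2, hh', hne'⟩ | ⟨h', hh'⟩, hk, hl⟩
      · simp at hk hl
        rw [hgu g' ⟨hg', hk.1, hl.1⟩, hhu h' ⟨hh', hk.2, hl.2⟩]
      · rcases hk' : h' k with _ | c' <;> rcases hl' : h' l with _ | d' <;>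
          simp [hk', hl'] at hk hl
        obtain rfl := hgu g' ⟨hg', hk.1, hl.1⟩
        exact absurd ⟨u', hgu2.symm⟩ hr
      · simp at hk
  · exact hinr k l hkl i c w
  · obtain ⟨f, ⟨hf, h1, h2⟩, hu⟩ := hinr l k hkl.symm j d u
    exact ⟨f, ⟨hf, h2, h1⟩, fun g hg => hu g ⟨hg.1, hg.2.2, hg.2.1⟩⟩
  · obtain ⟨h, ⟨hh, rfl, rfl⟩, hhu⟩ := hE hkl u w
    refine ⟨_, ⟨.hole h hh, rfl, rfl⟩, ?_⟩
    rintro _ ⟨⟨g', h', hg', hgU', hh'⟩ | ⟨g', u', h', hg', hgu2, hh', hne'⟩ | ⟨h', hh'⟩, hk, hl⟩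
    · simp at hk
    · rcases hk' : h' k with _ | c' <;> rcases hl' : h' l with _ | d' <;> simp [hk', hl'] at hk hl
      exact absurd (hC'.eq_of_agree hh' hnone hkl hk' hl') hne'
    · simp at hk hl
      rw [hhu h' ⟨hh', hk, hl⟩]

theorem twistable_wilson {T M U : Type*} [Nontrivial M] [Nontrivial T] {e : U → T}
    (he : Function.Injective e) (hes : ¬ Function.Surjective e)
    {B : Set (Option (Fin 4) → T)} {C : Set (Fin 4 → M)} {C' : Set (Fin 4 → Option M)}
    {E : Set (Fin 4 → U)}
    (hB : IsTD B) (hC : IsTD C) (hC' : IsTD C') (hnone : (fun _ => none) ∈ C') (hE : IsTD E) :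
    Twistable (T × M ⊕ U) := by
  -- a block `g₀` missing the truncated group carries a subdesign with point set `M`
  have hnr : ∃ t, t ∉ Set.range e := by simpa [Function.Surjective] using hes
  obtain ⟨t, ht⟩ := hnr
  obtain ⟨g₀, hg₀, hgt, -⟩ := (hB (Option.some_ne_none (0 : Fin 4)).symm t t).exists
  refine (isTD_wilsonBlock he hB hC hC' hnone hE).twistable
    (fun k => Set.range fun c : M => Sum.inl (g₀ (some k), c)) ?_ (fun k => ?_) ?_
  · rintro _ (⟨g', h', hg', hgU', hh'⟩ | ⟨g', u', h', hg', hgu2, hh', hne'⟩ | ⟨h', hh'⟩)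
      k l hkl hk hl m
    · simp at hk hl
      obtain rfl := hB.eq_of_agree hg₀ hg' (fun h => hkl (Option.some_injective _ h)) hk hl
      simp
    · rcases hk' : h' k with _ | c' <;> rcases hl' : h' l with _ | d' <;> simp [hk', hl'] at hk hl
      obtain rfl := hB.eq_of_agree hg₀ hg' (fun h => hkl (Option.some_injective _ h)) hk hl
      exact absurd ⟨u', by rw [← hgu2, hgt]⟩ ht
    · simp at hk
  · obtain ⟨c, d, hcd⟩ := exists_pair_ne M
    exact ⟨_, ⟨c, rfl⟩, _, ⟨d, rfl⟩, by simpa using hcd⟩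
  · obtain ⟨i, hi⟩ := exists_ne (g₀ (some 0))
    obtain ⟨c⟩ : Nonempty M := inferInstance
    intro h
    have : (Sum.inl (i, c) : T × M ⊕ U) ∈ Set.range fun c : M => Sum.inl (g₀ (some 0), c) :=
      h ▸ Set.mem_univ _
    obtain ⟨c', hc'⟩ := this
    simp at hc'
    exact hi hc'.1.symm

/-! ### Quasi-difference families -/

/-- Translation by `g` on `G` together with infinite points, which are fixed. -/
def shift {G W : Type*} [Add G] (g : G) : G ⊕ W → G ⊕ W := Sum.map (· + g) id

/-- The difference of two points, or `none` if one of them is infinite. -/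
def difference {G W : Type*} [Sub G] : G ⊕ W → G ⊕ W → Option G
  | .inl a, .inl b => some (b - a)
  | _, _ => none

/-- Base blocks `x j` on the group `G` with infinite points `W` such that each element of `G` is
once the difference of the finite points in any two given coordinates, each infinite point occurs
once in each coordinate, and no base block has two infinite points. -/
structure IsQuasiDifference {ι J G W : Type*} [Sub G] (x : J → ι → G ⊕ W) : Prop where
  finite_finite : ∀ k l, k ≠ l → ∀ d, ∃! j, difference (x j k) (x j l) = some d
  infinite : ∀ l w, ∃! j, x j l = .inr w
  finite_or_finite : ∀ k l, k ≠ l → ∀ j, (x j k).isLeft ∨ (x j l).isLeft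

/-- All translates of the base blocks, together with the blocks of a design on the infinite
points. -/
inductive DevelopedBlock {ι J G W : Type*} [Add G] (x : J → ι → G ⊕ W) (E : Set (ι → W)) :
    (ι → G ⊕ W) → Prop
  | developed (j : J) (g : G) : DevelopedBlock x E fun k => shift g (x j k)
  | hole (h : ι → W) (hh : h ∈ E) : DevelopedBlock x E fun k => Sum.inr (h k)

theorem shift_eq_inr {G W : Type*} [Add G] {g : G} {s : G ⊕ W} {w : W} :
    shift g s = .inr w ↔ s = .inr w := by
  cases s <;> simp [shift]

theorem shift_eq_inl {G W : Type*} [AddGroup G] {g a : G} {s : G ⊕ W} :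
    shift g s = .inl a ↔ s = .inl (a - g) := by
  cases s <;> simp [shift, eq_sub_iff_add_eq]

theorem isTD_developedBlock {ι J G W : Type*} [AddCommGroup G] {x : J → ι → G ⊕ W}
    {E : Set (ι → W)} (hx : IsQuasiDifference x) (hE : IsTD E) :
    IsTD {f | DevelopedBlock x E f} := by
  have hinr : ∀ k l, k ≠ l → ∀ a w, ∃! f, DevelopedBlock x E f ∧ f k = Sum.inl a ∧
      f l = Sum.inr w := by
    intro k l hkl a w
    obtain ⟨j, hj, hju⟩ := hx.infinite l w
    obtain ⟨c, hc⟩ := Sum.isLeft_iff.1 ((hx.finite_or_finite k l hkl j).resolve_right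
      (by simp [hj]))
    refine ⟨_, ⟨.developed j (a - c), by simp [shift_eq_inl, hc], shift_eq_inr.2 hj⟩, ?_⟩
    rintro _ ⟨⟨j', g⟩ | ⟨h, hh⟩, hk, hl⟩
    · obtain rfl := hju j' (shift_eq_inr.1 hl)
      rw [shift_eq_inl, hc, Sum.inl.injEq] at hk
      rw [hk, sub_sub_cancel]
    · simp at hk
  intro k l hkl a b
  rcases a with a | w <;> rcases b with b | w'
  · obtain ⟨j, hj, hju⟩ := hx.finite_finite k l hkl (b - a)
    rcases hk' : x j k with c | c <;> rcases hl' : x j l with d | d <;>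
      simp [hk', hl', difference] at hj
    refine ⟨_, ⟨.developed j (a - c), by simp [shift_eq_inl, hk'], ?_⟩, ?_⟩
    · rw [shift_eq_inl, hl']
      congr 1
      rw [← sub_eq_zero] at hj ⊢
      rw [← hj]; abel
    · rintro _ ⟨⟨j', g⟩ | ⟨h, hh⟩, hk, hl⟩
      · rw [shift_eq_inl] at hk hl
        obtain rfl := hju j' (by simp [hk, hl, difference])
        rw [hk', Sum.inl.injEq] at hk
        rw [hk, sub_sub_cancel]
      · simp at hk
  · exact hinr k l hkl a w'
  · obtain ⟨f, ⟨hf, h1, h2⟩, hu⟩ := hinr l k hkl.symm b w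
    exact ⟨f, ⟨hf, h2, h1⟩, fun g hg => hu g ⟨hg.1, hg.2.2, hg.2.1⟩⟩
  · obtain ⟨h, ⟨hh, rfl, rfl⟩, hhu⟩ := hE hkl w w'
    refine ⟨_, ⟨.hole h hh, rfl, rfl⟩, ?_⟩
    rintro _ ⟨⟨j', g⟩ | ⟨h', hh'⟩, hk, hl⟩
    · have := hx.finite_or_finite k l hkl j'
      rw [shift_eq_inr] at hk hl
      simp [hk, hl] at this
    · simp at hk hl
      rw [hhu h' ⟨hh', hk, hl⟩]

theorem IsQuasiDifference.twistable {J G W : Type*} [AddCommGroup G] [Nontrivial W]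
    {x : J → Fin 4 → G ⊕ W} (hx : IsQuasiDifference x) {E : Set (Fin 4 → W)} (hE : IsTD E) :
    Twistable (G ⊕ W) := by
  refine (isTD_developedBlock hx hE).twistable (fun _ => Set.range Sum.inr) ?_ (fun _ => ?_) ?_
  · rintro _ (⟨j, g⟩ | ⟨h, hh⟩) k l hkl ⟨w, hk⟩ ⟨w', hl⟩ m
    · have := hx.finite_or_finite k l hkl j
      rw [eq_comm, shift_eq_inr] at hk hl
      simp [hk, hl] at this
    · simp
  · obtain ⟨c, d, hcd⟩ := exists_pair_ne W
    exact ⟨_, ⟨c, rfl⟩, _, ⟨d, rfl⟩, by simpa using hcd⟩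
  · intro h
    have : (Sum.inl 0 : G ⊕ W) ∈ Set.range (Sum.inr : W → G ⊕ W) := h ▸ Set.mem_univ _
    simp at this

/-! ### Twisting linear designs over a field -/

/-- Here the blocks are `(x, y, x + y, x + s * y)`, the twisted ones are those with `x ∈ W`, and the
rotated symbols are `0` and `1`. If two blocks agree in two coordinates after identifying `0` with
`1`, the difference of their first coordinates is an integral combination of `1` and
`(1 - s)⁻¹`. -/
theorem twistable_of_field {F : Type*} [Field F] (s : F) (hs : s ≠ 0) (hs1 : s ≠ 1)
    (W : AddSubgroup F) (h1 : 1 ∈ W) (hsW : (1 - s)⁻¹ ∈ W) (hW : W ≠ ⊤) : Twistable F := by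
  have hs1' : 1 - s ≠ 0 := sub_ne_zero.2 hs1.symm
  have hB : IsTD (linearBlocks (R := F) ![1, 0, 1, 1] ![0, 1, 1, s]) :=
    isTD_linearBlocks fun k l hkl => by
      fin_cases k <;> fin_cases l <;> simp [hs, hs1', sub_ne_zero, hs1] at hkl ⊢
  have hint : ∀ {x y : F}, Merged 0 1 x y → ∃ n : ℤ, y - x = n := by
    rintro x y (rfl | ⟨rfl | rfl, rfl | rfl⟩)
    exacts [⟨0, by simp⟩, ⟨0, by simp⟩, ⟨1, by simp⟩, ⟨-1, by simp⟩, ⟨0, by simp⟩]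
  have hmem : ∀ n : ℤ, (n : F) ∈ W := fun n => by simpa using W.zsmul_mem h1 n
  have hmem' : ∀ n : ℤ, (n : F) * (1 - s)⁻¹ ∈ W := fun n => by simpa using W.zsmul_mem hsW n
  obtain ⟨x, hx⟩ : ∃ x, x ∉ W := by
    by_contra! h
    exact hW (eq_top_iff.2 fun x _ => h x)
  refine ⟨_, {f | f 0 ∈ W}, ![0, 0, 0, 0], ![0, 0, 1, 1], hB, ?_, rfl, rfl, ?_, ?_, ?_⟩
  · intro f hf g hg k l hkl hk hl hfD
    suffices h : g 0 - f 0 ∈ W by simpa using W.add_mem h hfD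
    obtain ⟨⟨p, q⟩, rfl⟩ := hf
    obtain ⟨⟨p', q'⟩, rfl⟩ := hg
    clear hfD
    wlog hlt : k < l generalizing k l
    · exact this l k hkl.symm hl hk (lt_of_le_of_ne (not_lt.1 hlt) hkl.symm)
    fin_cases k <;> fin_cases l <;> simp [merged_self] at hlt hk hl ⊢
    · simp [hk]
    · simp [hk]
    · simp [hk]
    · obtain ⟨n, hn⟩ := hint hl
      convert hmem n using 1
      rw [← hn, hk]; ring
    · obtain ⟨n, hn⟩ := hint hl
      convert hmem n using 1
      rw [← hn, hk]; ring
    · obtain ⟨m, hm⟩ := hint hk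
      obtain ⟨n, hn⟩ := hint hl
      convert W.add_mem (hmem m) (hmem' (n - m)) using 1
      push_cast
      field_simp
      linear_combination (-s) * hm + hn
  · intro k hk
    fin_cases k <;> simp at hk ⊢
  · intro k hk
    refine ⟨fun _ => 0, zero_mem_linearBlocks _ _, W.zero_mem, ?_⟩
    fin_cases k <;> simp at hk ⊢
  · intro k hk
    have hk0 : (0 : Fin 4) ≠ k := by rintro rfl; exact absurd hk (by decide)
    obtain ⟨f, hf, hf0, hfk⟩ := (hB hk0 x (![0, 0, 0, 0] k)).exists
    exact ⟨f, hf, fun h => hx (hf0 ▸ h), hfk⟩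

theorem exists_notMem_of_card_lt {F : Type*} [Finite F] (S : Finset F) (h : S.card < Nat.card F) :
    ∃ x, x ∉ S := by
  by_contra! hS
  have := Fintype.ofFinite F
  rw [Nat.card_eq_fintype_card, ← Finset.card_univ] at h
  exact absurd (Finset.card_le_card fun x _ => hS x) (not_le.2 h)

/-- The span of `1` and `(1 - s)⁻¹` over the prime field has dimension at most two, hence is
proper. -/
theorem twistable_fin_eight : Twistable (Fin 8) := by
  classical
  have : Fact (Nat.Prime 2) := ⟨Nat.prime_two⟩
  have hc : Nat.card (GaloisField 2 3) = 8 := GaloisField.card 2 3 (by norm_num)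
  obtain ⟨s, hs⟩ := exists_notMem_of_card_lt ({0, 1} : Finset (GaloisField 2 3))
    (by rw [hc]; exact Finset.card_le_two.trans_lt (by norm_num))
  simp only [Finset.mem_insert, Finset.mem_singleton, not_or] at hs
  let W := Submodule.span (ZMod 2)
    (({1, (1 - s)⁻¹} : Finset (GaloisField 2 3)) : Set (GaloisField 2 3))
  refine (twistable_of_field s hs.1 hs.2 W.toAddSubgroup (Submodule.subset_span (by simp))
    (Submodule.subset_span (by simp)) fun h => ?_).map (Finite.equivFinOfCardEq hc)
  have hW : W = ⊤ := Submodule.toAddSubgroup_injective h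
  have h1 : Module.finrank (ZMod 2) W ≤ 2 :=
    (finrank_span_finset_le_card _).trans Finset.card_le_two
  rw [hW, finrank_top, GaloisField.finrank 2 (by norm_num)] at h1
  omega

/-! ### Existence of the ingredients -/

theorem exists_isTD_four_of_card {α : Type*} [Finite α] (x₀ : α)
    (h : Odd (Nat.card α) ∨ Nat.card α = 4) :
    ∃ B : Set (Fin 4 → α), IsTD B ∧ (fun _ => x₀) ∈ B := by
  classical
  suffices h' : ∃ (R : Type) (_ : CommRing R) (_ : Nonempty (R ≃ α)) (s : R),
      IsUnit s ∧ IsUnit (s - 1) by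
    obtain ⟨R, _, ⟨e⟩, s, hs, hs1⟩ := h'
    obtain ⟨B, hB, h0⟩ := exists_isTD_four hs hs1
    refine ⟨_, hB.map (e.trans (Equiv.swap (e 0) x₀)), ?_⟩
    simpa using h0
  rcases h with h | h
  · have : NeZero (Nat.card α) := ⟨fun h0 => by simp [h0] at h⟩
    refine ⟨ZMod (Nat.card α), inferInstance,
      ⟨(ZMod.finEquiv _).symm.toEquiv.trans (Finite.equivFin α).symm⟩, 2, ?_, ?_⟩
    · exact_mod_cast (ZMod.isUnit_iff_coprime 2 _).2 h.coprime_two_left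
    · rw [show (2 : ZMod (Nat.card α)) - 1 = 1 by ring]
      exact isUnit_one
  · have : Fact (Nat.Prime 2) := ⟨Nat.prime_two⟩
    have hc : Nat.card (GaloisField 2 2) = 4 := GaloisField.card 2 2 (by norm_num)
    obtain ⟨s, hs⟩ := exists_notMem_of_card_lt ({0, 1} : Finset (GaloisField 2 2))
      (by rw [hc]; exact Finset.card_le_two.trans_lt (by norm_num))
    simp only [Finset.mem_insert, Finset.mem_singleton, not_or] at hs
    exact ⟨GaloisField 2 2, inferInstance,
      ⟨(Finite.equivFinOfCardEq hc).trans (Finite.equivFinOfCardEq h).symm⟩, s,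
      isUnit_iff_ne_zero.2 hs.1, isUnit_iff_ne_zero.2 (sub_ne_zero.2 hs.2)⟩

theorem exists_isTD_five_zmod {n : ℕ} (h2 : Nat.Coprime 2 n) (h3 : Nat.Coprime 3 n) :
    ∃ B : Set (Option (Fin 4) → ZMod n), IsTD B := by
  have hu2 : IsUnit (2 : ZMod n) := by exact_mod_cast (ZMod.isUnit_iff_coprime 2 n).2 h2
  have hu3 : IsUnit (3 : ZMod n) := by exact_mod_cast (ZMod.isUnit_iff_coprime 3 n).2 h3
  refine exists_isTD_five (s := 2) (t := -1) hu2 ?_ isUnit_one.neg ?_ ?_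
  · rw [show (2 : ZMod n) - 1 = 1 by ring]; exact isUnit_one
  · rw [show (-1 : ZMod n) - 1 = -2 by ring]; exact hu2.neg
  · rw [show (-1 : ZMod n) - 2 = -3 by ring]; exact hu3.neg

theorem exists_isTD_five_field {F : Type*} [Field F] [Finite F] (h : 4 ≤ Nat.card F) :
    ∃ B : Set (Option (Fin 4) → F), IsTD B := by
  classical
  obtain ⟨s, hs⟩ := exists_notMem_of_card_lt ({0, 1} : Finset F)
    (Finset.card_le_two.trans_lt (by omega))
  obtain ⟨t, ht⟩ := exists_notMem_of_card_lt ({0, 1, s} : Finset F)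
    (Finset.card_le_three.trans_lt (by omega))
  simp only [Finset.mem_insert, Finset.mem_singleton, not_or] at hs ht
  exact exists_isTD_five (isUnit_iff_ne_zero.2 hs.1) (isUnit_iff_ne_zero.2 (sub_ne_zero.2 hs.2))
    (isUnit_iff_ne_zero.2 ht.1) (isUnit_iff_ne_zero.2 (sub_ne_zero.2 ht.2.1))
    (isUnit_iff_ne_zero.2 (sub_ne_zero.2 ht.2.2))

theorem exists_isTD_five_primePow {p n : ℕ} (hp : p.Prime) (hn : n ≠ 0) (h : 4 ≤ p ^ n) :
    ∃ B : Set (Option (Fin 4) → Fin (p ^ n)), IsTD B := by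
  have : Fact p.Prime := ⟨hp⟩
  have hc := GaloisField.card p n hn
  obtain ⟨B, hB⟩ := exists_isTD_five_field (F := GaloisField p n) (by rwa [hc])
  exact ⟨_, hB.map (Finite.equivFinOfCardEq hc)⟩

/-- Orders for which a linear design with five groups is used. -/
def IsWilsonOrder (t : ℕ) : Prop :=
  t % 6 = 1 ∨ t % 6 = 5 ∨ t = 4 ∨ t = 8 ∨ t = 9 ∨ t = 16

instance : DecidablePred IsWilsonOrder := fun t => by
  unfold IsWilsonOrder; infer_instance

theorem exists_isTD_five_fin {t : ℕ} (ht : IsWilsonOrder t) :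
    ∃ B : Set (Option (Fin 4) → Fin t), IsTD B := by
  unfold IsWilsonOrder at ht
  by_cases h : t % 6 = 1 ∨ t % 6 = 5
  · have : NeZero t := ⟨by omega⟩
    obtain ⟨B, hB⟩ := exists_isTD_five_zmod (n := t)
      ((Nat.Prime.coprime_iff_not_dvd Nat.prime_two).2 (by omega))
      ((Nat.Prime.coprime_iff_not_dvd Nat.prime_three).2 (by omega))
    exact ⟨_, hB.map (ZMod.finEquiv t).symm.toEquiv⟩
  · rcases ht with h' | h' | rfl | rfl | rfl | rfl
    · exact absurd (Or.inl h') h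
    · exact absurd (Or.inr h') h
    · exact exists_isTD_five_primePow (p := 2) (n := 2) Nat.prime_two (by norm_num) (by norm_num)
    · exact exists_isTD_five_primePow (p := 2) (n := 3) Nat.prime_two (by norm_num) (by norm_num)
    · exact exists_isTD_five_primePow (p := 3) (n := 2) Nat.prime_three (by norm_num) (by norm_num)
    · exact exists_isTD_five_primePow (p := 2) (n := 4) Nat.prime_two (by norm_num) (by norm_num)

/-- Parameters to which Wilson's construction is applied, giving a design of order `t * m + u`. -/
structure IsWilsonTriple (m t u : ℕ) : Prop where
  weight : m = 3 ∨ m = 4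
  order : IsWilsonOrder t
  one_lt : 1 < t
  lt : u < t
  hole : u = 0 ∨ u % 2 = 1

instance (m t u : ℕ) : Decidable (IsWilsonTriple m t u) :=
  decidable_of_iff ((m = 3 ∨ m = 4) ∧ IsWilsonOrder t ∧ 1 < t ∧ u < t ∧ (u = 0 ∨ u % 2 = 1))
    ⟨fun ⟨h₁, h₂, h₃, h₄, h₅⟩ => ⟨h₁, h₂, h₃, h₄, h₅⟩, fun ⟨h₁, h₂, h₃, h₄, h₅⟩ =>
      ⟨h₁, h₂, h₃, h₄, h₅⟩⟩

theorem IsWilsonTriple.twistable {m t u : ℕ} (h : IsWilsonTriple m t u) :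
    Twistable (Fin (t * m + u)) := by
  obtain ⟨hm, ht, ht1, hut, hu⟩ := h
  obtain ⟨B, hB⟩ := exists_isTD_five_fin ht
  have : Nontrivial (Fin m) := Fin.nontrivial_iff_two_le.2 (by omega)
  have : Nontrivial (Fin t) := Fin.nontrivial_iff_two_le.2 (by omega)
  obtain ⟨C, hC, -⟩ := exists_isTD_four_of_card (⟨0, by omega⟩ : Fin m) (by
    rw [Nat.card_fin, Nat.odd_iff]; omega)
  obtain ⟨C', hC', hnone⟩ := exists_isTD_four_of_card (none : Option (Fin m)) (by
    rw [Finite.card_option, Nat.card_fin, Nat.odd_iff]; omega)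
  obtain ⟨E, hE⟩ : ∃ E : Set (Fin 4 → Fin u), IsTD E := by
    rcases hu with rfl | hu
    · exact ⟨∅, fun k l hkl x => x.elim0⟩
    · obtain ⟨E, hE, -⟩ := exists_isTD_four_of_card (⟨0, by omega⟩ : Fin u)
        (by rw [Nat.card_fin, Nat.odd_iff]; omega)
      exact ⟨E, hE⟩
  refine (twistable_wilson (e := Fin.castLE hut.le) (Fin.castLE_injective _) (fun hs => ?_) hB hC
    hC' hnone hE).map ((finProdFinEquiv.sumCongr (Equiv.refl _)).trans finSumFinEquiv)
  exact absurd (Fintype.card_le_of_surjective _ hs) (by simpa using hut)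

theorem exists_isWilsonTriple {v : ℕ} (h : 12 ≤ v) (h14 : v ≠ 14) :
    ∃ m t u, IsWilsonTriple m t u ∧ v = t * m + u := by
  by_cases hv : v < 125
  · have key : ∀ v < 125, 12 ≤ v → v ≠ 14 → ∃ t < 42, ∃ m < 5, t * m ≤ v ∧
      IsWilsonTriple m t (v - t * m) := by decide +kernel
    obtain ⟨t, -, m, -, hle, htr⟩ := key v hv h h14
    exact ⟨m, t, v - t * m, htr, by omega⟩
  · rcases Nat.even_or_odd' v with ⟨w, rfl | rfl⟩
    -- the intervals `[18 * s + 4, 24 * s + 2]` and `[24 * s + 5, 30 * s + 3]` of the even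
    -- and the odd `v` reached with `t = 6 * s + 1` leave no gap above `125`
    · set s := (2 * w - 4) / 18 with hs
      refine ⟨3, 6 * s + 1, 2 * w - (6 * s + 1) * 3, ⟨Or.inl rfl, Or.inl ?_, ?_, ?_, ?_⟩, ?_⟩ <;>
        omega
    · set s := (2 * w + 1 - 5) / 24 with hs
      refine ⟨4, 6 * s + 1, 2 * w + 1 - (6 * s + 1) * 4,
        ⟨Or.inr rfl, Or.inl ?_, ?_, ?_, ?_⟩, ?_⟩ <;>
        omega

/-! ### Orders nine, ten, eleven and fourteen -/

/-- The base blocks given by the columns of a table of numbers: a number below `n` is an element of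
`ℤ / n`, and `n`, `n + 1`, `n + 2` are the three infinite points. -/
def tableBlock {n r : ℕ} [NeZero n] (A : Fin 4 → Fin r → ℕ) (j : Fin r) (k : Fin 4) :
    Fin n ⊕ Fin 3 :=
  if A k j < n then .inl (Fin.ofNat n (A k j)) else .inr (Fin.ofNat 3 (A k j - n))

instance {ι J G W : Type*} [Fintype ι] [DecidableEq ι] [Fintype J] [DecidableEq J] [Sub G]
    [Fintype G] [DecidableEq G] [Fintype W] [DecidableEq W] (x : J → ι → G ⊕ W) :
    Decidable (IsQuasiDifference x) :=
  decidable_of_iff ((∀ k l, k ≠ l → ∀ d, ∃ j, difference (x j k) (x j l) = some d ∧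
      ∀ j', difference (x j' k) (x j' l) = some d → j' = j) ∧
    (∀ l w, ∃ j, x j l = .inr w ∧ ∀ j', x j' l = .inr w → j' = j) ∧
    ∀ k l, k ≠ l → ∀ j, (x j k).isLeft ∨ (x j l).isLeft)
    ⟨fun h => ⟨h.1, h.2.1, h.2.2⟩, fun h => ⟨h.1, h.2, h.3⟩⟩

theorem twistable_of_table {n r : ℕ} [NeZero n] (A : Fin 4 → Fin r → ℕ)
    (hA : IsQuasiDifference (tableBlock (n := n) A)) : Twistable (Fin (n + 3)) := by
  obtain ⟨E, hE, -⟩ := exists_isTD_four_of_card (0 : Fin 3) (by rw [Nat.card_fin]; decide)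
  exact (hA.twistable hE).map finSumFinEquiv

theorem twistable_fin_nine : Twistable (Fin 9) :=
  twistable_of_table (n := 6)
    ![![6, 7, 8, 0, 0, 0, 0, 0, 0, 0, 0, 0],
      ![0, 0, 0, 6, 7, 8, 3, 2, 5, 0, 4, 1],
      ![4, 1, 0, 2, 3, 1, 6, 7, 8, 5, 0, 4],
      ![3, 2, 4, 4, 0, 1, 2, 3, 5, 6, 7, 8]]
    (by decide +kernel)

theorem twistable_fin_ten : Twistable (Fin 10) :=
  twistable_of_table (n := 7)
    ![![0, 7, 8, 9, 0, 0, 0, 0, 0, 0, 0, 0, 0],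
      ![4, 0, 0, 0, 7, 8, 9, 6, 5, 0, 1, 2, 3],
      ![2, 1, 2, 3, 4, 0, 6, 7, 8, 9, 5, 1, 3],
      ![5, 5, 0, 2, 4, 2, 0, 3, 1, 6, 7, 8, 9]]
    (by decide +kernel)

theorem twistable_fin_eleven : Twistable (Fin 11) :=
  twistable_of_table (n := 8)
    ![![0, 0, 8, 9, 10, 0, 0, 0, 0, 0, 0, 0, 0, 0],
      ![4, 2, 0, 0, 0, 8, 9, 10, 3, 1, 0, 6, 5, 7],
      ![2, 5, 1, 4, 0, 6, 0, 7, 8, 9, 10, 3, 4, 1],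
      ![3, 0, 1, 0, 5, 4, 7, 1, 6, 5, 2, 8, 9, 10]]
    (by decide +kernel)

theorem twistable_fin_fourteen : Twistable (Fin 14) :=
  twistable_of_table (n := 11)
    ![![0, 0, 0, 0, 0, 11, 12, 13, 0, 0, 0, 0, 0, 0, 0, 0, 0],
      ![4, 2, 3, 8, 7, 0, 0, 0, 11, 12, 13, 1, 5, 0, 6, 10, 9],
      ![10, 2, 4, 0, 6, 9, 4, 5, 7, 8, 9, 11, 12, 13, 3, 1, 5],
      ![0, 4, 3, 7, 1, 3, 1, 8, 5, 8, 2, 10, 9, 6, 11, 12, 13]]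
    (by decide +kernel)

/-! ### All orders from eight on -/

theorem twistable_fin {v : ℕ} (hv : 8 ≤ v) : Twistable (Fin v) := by
  by_cases h : 12 ≤ v ∧ v ≠ 14
  · obtain ⟨m, t, u, htr, rfl⟩ := exists_isWilsonTriple h.1 h.2
    exact htr.twistable
  · obtain rfl | rfl | rfl | rfl | rfl : v = 8 ∨ v = 9 ∨ v = 10 ∨ v = 11 ∨ v = 14 := by omega
    exacts [twistable_fin_eight, twistable_fin_nine, twistable_fin_ten, twistable_fin_eleven,
      twistable_fin_fourteen]

theorem theorem3p7 (v : ℕ) (hv : 8 ≤ v) :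
    ∃ Φ : Fin 2 → QArray v, IsNonclassicalMOQLS Φ :=
  exists_isNonclassicalMOQLS_of_twistable (by omega) (twistable_fin hv)
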